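/- Let $n \ge 2$ be an integer and let $H_n$ denote the set of all $n \times n$ complex hermitian matrices, equipped with the Loewner order: $A \le B$ if and only if $B - A$ is positive semidefinite. Let $\phi : H_n \to H_n$ be a bijective map such that for every pair $A, B \in H_n$ we have $$A \le B \iff \phi(A) \le \phi(B).$$ Then there exist an invertible $n \times n$ complex matrix $T$ and a matrix $S \in H_n$ such that either $$\phi(A) = T A T^* + S \quad \text{for all } A \in H_n,$$ or $$\phi(A) = T A^t T^* + S \quad \text{for all } A \in H_n.$$ Here $T^*$ denotes the conjugate transpose of $T$ and $A^t$ the transpose of $A$. -/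

import Mathlib

open scoped ComplexOrder MatrixOrder

/-- The set of all `n × n` complex hermitian matrices. -/
abbrev HermMat (n : ℕ) : Type :=
  {A : Matrix (Fin n) (Fin n) ℂ // A.IsHermitian}

/-- The order on matrices used here is the Loewner order: `A ≤ B` means that `B - A` is positive
semidefinite, that is, `x* A x ≤ x* B x` for every complex vector `x`. -/
theorem hermMat_le_iff {n : ℕ} (A B : HermMat n) :
    A.1 ≤ B.1 ↔ (B.1 - A.1).PosSemidef := Iff.rfl

/-!
An order automorphism of the hermitian matrices is affine, and a linear order automorphism permutes
the rank one positive semidefinite matrices, which leaves only congruences and the transposition.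

**Affinity.** This part works in any ordered vector space whose cone has enough exposed extreme
rays (`HasRichExtremeRays`). A positive vector `p` is extreme if and only if the interval `[0, p]`
is a chain, so an order isomorphism `φ` maps lines in extreme directions onto such lines
(`IsExtremeVector.map_line`). If every point of a line along `p` lies below some point of a line
along `q`, then `p` and `q` are parallel; hence `φ` maps parallel lines in extreme directions to
parallel lines (`IsExtremeVector.map_parallel`). Comparing the sides of the image of a
parallelogram with extreme sides shows that the increment `φ (a + p) - φ a` does not change when `a`
moves along an extreme direction not parallel to `p`. These directions generate the space (here the
size of the matrices has to be at least two), so the increment is independent of `a`. Thus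
`φ - φ 0` is additive, and being monotone it is linear (`HasRichExtremeRays.exists_linearMap_eq`).

**Linear maps.** The extreme vectors of the positive semidefinite cone are the matrices `v v*` with
`v ≠ 0`, so the linear part `L` maps every `v v*` to some `w w*`. After a congruence `L` fixes the
diagonal matrix units and the all-ones matrix. Positivity then shows that `L` preserves diagonal
entries; as the images of the `v v*` have rank one, it follows that the `(i, j)` entry of `L A` is
the image of the `(i, j)` entry of `A` under an isometry of `ℂ` fixing `1`, that is, under the
identity or the conjugation. The vectors with a single entry `I` and all other entries `1` show that
the choice is the same for all pairs `(i, j)` (`PreservesRankOne.eq_id_or_transpose`).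
-/

/-! ### Order isomorphisms of ordered vector spaces with many exposed extreme rays -/

section OrderedSpace

variable {V : Type*} [AddCommGroup V] [PartialOrder V] [Module ℝ V]

/-- A positive vector spanning an extreme ray of the positive cone: every positive vector below it
is one of its multiples. The zero vector is excluded. -/
def IsExtremeVector (p : V) : Prop :=
  0 < p ∧ ∀ x, 0 ≤ x → x ≤ p → ∃ t : ℝ, x = t • p

/-- The properties of the positive cone that force order isomorphisms to be affine. Positive
semidefinite matrices of size at least two satisfy them; the cone of `ℝ` does not, since there
`generates` fails. -/
structure HasRichExtremeRays (V : Type*) [AddCommGroup V] [PartialOrder V] [Module ℝ V] :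
    Prop where
  archimedean : ∀ x y : V, (∀ ε : ℝ, 0 < ε → x ≤ ε • y) → x ≤ 0
  /-- A line along `p` lies below a line along `q` only if `p` and `q` are parallel. -/
  exposed : ∀ p q d : V, IsExtremeVector p → IsExtremeVector q →
    (∀ s : ℝ, ∃ s' : ℝ, s • p ≤ d + s' • q) → ∃ c : ℝ, p = c • q
  /-- The extreme vectors not parallel to a given one generate the space. -/
  generates : ∀ p : V, IsExtremeVector p →
    AddSubgroup.closure {q : V | IsExtremeVector q ∧ ∀ c : ℝ, q ≠ c • p} = ⊤
  exists_isExtremeVector : ∃ p : V, IsExtremeVector p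

theorem IsExtremeVector.smul [IsOrderedModule ℝ V] {p : V} (hp : IsExtremeVector p)
    {t : ℝ} (ht : 0 < t) : IsExtremeVector (t • p) := by
  refine ⟨(smul_nonneg ht.le hp.1.le).lt_of_ne' (smul_ne_zero ht.ne' hp.1.ne'),
    fun x hx hxp => ?_⟩
  obtain ⟨s, hs⟩ := hp.2 (t⁻¹ • x) (smul_nonneg (inv_nonneg.2 ht.le) hx) (by
    have := smul_le_smul_of_nonneg_left hxp (inv_nonneg.2 ht.le)
    rwa [smul_smul, inv_mul_cancel₀ ht.ne', one_smul] at this)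
  refine ⟨s, ?_⟩
  rw [smul_comm, ← hs, smul_smul, mul_inv_cancel₀ ht.ne', one_smul]

variable [IsOrderedAddMonoid V]

theorem HasRichExtremeRays.exists_ge (hV : HasRichExtremeRays V) (a b : V) :
    ∃ c, a ≤ c ∧ b ≤ c := by
  obtain ⟨p, hp⟩ := hV.exists_isExtremeVector
  have key : ∀ x : V, ∃ u : V, 0 ≤ u ∧ x ≤ u ∧ -x ≤ u := by
    intro x
    have hx : x ∈ AddSubgroup.closure {q : V | IsExtremeVector q ∧ ∀ c : ℝ, q ≠ c • p} := by
      rw [hV.generates p hp]; trivial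
    induction hx using AddSubgroup.closure_induction with
    | mem q hq => exact ⟨q, hq.1.1.le, le_rfl, (neg_nonpos.2 hq.1.1.le).trans hq.1.1.le⟩
    | zero => exact ⟨0, by simp⟩
    | add y z _ _ hy hz =>
      obtain ⟨u, h1, h2, h3⟩ := hy
      obtain ⟨v, k1, k2, k3⟩ := hz
      exact ⟨u + v, add_nonneg h1 k1, add_le_add h2 k2, by
        rw [neg_add]; exact add_le_add h3 k3⟩
    | neg y _ hy =>
      obtain ⟨u, h1, h2, h3⟩ := hy
      exact ⟨u, h1, h3, by rwa [neg_neg]⟩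
  obtain ⟨u, hu, hau, -⟩ := key a
  obtain ⟨v, hv, hbv, -⟩ := key b
  exact ⟨u + v, hau.trans (le_add_of_nonneg_right hv), hbv.trans (le_add_of_nonneg_left hu)⟩

section Lines

variable [IsOrderedModule ℝ V]

/-- If `p` spans an extreme ray, the interval `[0, p]` is a chain. -/
theorem IsExtremeVector.total_of_le {p : V} (hp : IsExtremeVector p) {y z : V} (hy : 0 ≤ y)
    (hyp : y ≤ p) (hz : 0 ≤ z) (hzp : z ≤ p) : y ≤ z ∨ z ≤ y := by
  obtain ⟨s, rfl⟩ := hp.2 y hy hyp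
  obtain ⟨t, rfl⟩ := hp.2 z hz hzp
  rcases le_total s t with h | h
  · exact Or.inl (smul_le_smul_of_nonneg_right h hp.1.le)
  · exact Or.inr (smul_le_smul_of_nonneg_right h hp.1.le)

/-- A positive vector whose interval `[0, x]` is a chain spans an extreme ray: `y ∈ [0, x]` equals
`t • x` where `t` is the largest number with `t • x ≤ y`. -/
theorem IsExtremeVector.of_total (hV : HasRichExtremeRays V) {x : V} (hx : 0 < x)
    (h : ∀ y z, 0 ≤ y → y ≤ x → 0 ≤ z → z ≤ x → y ≤ z ∨ z ≤ y) : IsExtremeVector x := by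
  refine ⟨hx, fun y hy hyx => ?_⟩
  set S : Set ℝ := {t | 0 ≤ t ∧ t ≤ 1 ∧ t • x ≤ y} with hS
  have hbdd : BddAbove S := ⟨1, fun t ht => ht.2.1⟩
  have h0 : (0 : ℝ) ∈ S := ⟨le_rfl, zero_le_one, by simpa using hy⟩
  refine ⟨sSup S, le_antisymm ?_ ?_⟩
  · rw [← sub_nonpos]
    refine hV.archimedean _ x fun ε hε => ?_
    rw [sub_le_iff_le_add, ← add_smul]
    have hnot : ε + sSup S ∉ S := fun hm => by
      have := le_csSup hbdd hm
      linarith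
    have hpos : 0 ≤ ε + sSup S := add_nonneg hε.le (le_csSup hbdd h0)
    rcases le_total (ε + sSup S) 1 with h1 | h1
    · have hle : (ε + sSup S) • x ≤ x := by
        simpa using smul_le_smul_of_nonneg_right h1 hx.le
      rcases h y _ hy hyx (smul_nonneg hpos hx.le) hle with h2 | h2
      · exact h2
      · exact absurd ⟨hpos, h1, h2⟩ hnot
    · exact hyx.trans (by simpa using smul_le_smul_of_nonneg_right h1 hx.le)
  · rw [← sub_nonpos]
    refine hV.archimedean _ x fun ε hε => ?_
    obtain ⟨t, ht, hlt⟩ := exists_lt_of_lt_csSup ⟨0, h0⟩ (sub_lt_self (sSup S) hε)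
    have h1 : (sSup S - ε) • x ≤ y :=
      (smul_le_smul_of_nonneg_right hlt.le hx.le).trans ht.2.2
    rw [sub_smul] at h1
    rw [sub_le_comm]
    exact h1

/-- Order isomorphisms preserve adjacency: comparable pairs that differ by an extreme vector. -/
theorem IsExtremeVector.map_sub (hV : HasRichExtremeRays V) (φ : V ≃o V) {a b : V}
    (h : IsExtremeVector (b - a)) : IsExtremeVector (φ b - φ a) := by
  have hab : a < b := sub_pos.1 h.1
  refine IsExtremeVector.of_total hV (sub_pos.2 (φ.lt_iff_lt.2 hab)) fun y z hy hyx hz hzx => ?_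
  have key : ∀ y, 0 ≤ y → y ≤ φ b - φ a →
      0 ≤ φ.symm (φ a + y) - a ∧ φ.symm (φ a + y) - a ≤ b - a := by
    intro y hy hyx
    rw [sub_nonneg, sub_le_sub_iff_right, φ.le_symm_apply, φ.symm_apply_le]
    exact ⟨le_add_of_nonneg_right hy, by rw [add_comm]; exact le_sub_iff_add_le.1 hyx⟩
  obtain ⟨hy1, hy2⟩ := key y hy hyx
  obtain ⟨hz1, hz2⟩ := key z hz hzx
  simpa using h.total_of_le hy1 hy2 hz1 hz2

/-- The image of a line in an extreme direction is contained in a line. -/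
theorem IsExtremeVector.map_line (hV : HasRichExtremeRays V) (φ : V ≃o V) {p : V}
    (hp : IsExtremeVector p) (a : V) (t : ℝ) :
    ∃ s : ℝ, φ (a + t • p) = φ a + s • (φ (a + p) - φ a) := by
  have hext : ∀ u v : ℝ, u < v → IsExtremeVector (φ (a + v • p) - φ (a + u • p)) := by
    intro u v huv
    refine IsExtremeVector.map_sub hV φ ?_
    rw [add_sub_add_left_eq_sub, ← sub_smul]
    exact hp.smul (sub_pos.2 huv)
  -- Subintervals of `[u, v]` have increments that are multiples of the increment over `[u, v]`.
  have hsub : ∀ u v u' v' : ℝ, u < v → u ≤ u' → u' ≤ v' → v' ≤ v →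
      ∃ s : ℝ, φ (a + v' • p) - φ (a + u' • p) = s • (φ (a + v • p) - φ (a + u • p)) := by
    intro u v u' v' huv h1 h2 h3
    have hm : ∀ r r' : ℝ, r ≤ r' → φ (a + r • p) ≤ φ (a + r' • p) := fun r r' hr =>
      φ.monotone (by gcongr; exact hp.1.le)
    exact (hext u v huv).2 _ (sub_nonneg.2 (hm _ _ h2)) (sub_le_sub (hm _ _ h3) (hm _ _ h1))
  set m := min t 0
  set M := max t 1
  have hmM : m < M := (min_le_right t 0).trans_lt (zero_lt_one.trans_le (le_max_right t 1))
  obtain ⟨r, hr⟩ := hsub m M 0 1 hmM (min_le_right _ _) zero_le_one (le_max_right _ _)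
  have hq := (hext 0 1 zero_lt_one).1.ne'
  have hr0 : r ≠ 0 := by
    rintro rfl
    exact hq (hr.trans (zero_smul ℝ _))
  simp only [zero_smul, add_zero, one_smul] at hr
  have hD : φ (a + M • p) - φ (a + m • p) = r⁻¹ • (φ (a + p) - φ a) := by
    rw [hr, smul_smul, inv_mul_cancel₀ hr0, one_smul]
  rcases le_total 0 t with ht | ht
  · obtain ⟨s, hs⟩ := hsub m M 0 t hmM (min_le_right _ _) ht (le_max_left _ _)
    refine ⟨s * r⁻¹, ?_⟩
    rw [mul_smul, ← hD, ← hs]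
    simp
  · obtain ⟨s, hs⟩ := hsub m M t 0 hmM (min_le_left _ _) ht (zero_le_one.trans (le_max_right _ _))
    refine ⟨-(s * r⁻¹), ?_⟩
    rw [neg_smul, mul_smul, ← hD, ← hs]
    simp

/-- Together with `IsExtremeVector.map_line`: lines in extreme directions map onto lines. -/
theorem IsExtremeVector.exists_map_line_eq (hV : HasRichExtremeRays V) (φ : V ≃o V) {p : V}
    (hp : IsExtremeVector p) (a : V) (s : ℝ) :
    ∃ t : ℝ, φ (a + t • p) = φ a + s • (φ (a + p) - φ a) := by
  have hq : IsExtremeVector (φ (a + p) - φ a) :=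
    IsExtremeVector.map_sub hV φ (by rwa [add_sub_cancel_left])
  obtain ⟨t, ht⟩ := hq.map_line hV φ.symm (φ a) s
  refine ⟨t, ?_⟩
  simp only [add_sub_cancel, OrderIso.symm_apply_apply, add_sub_cancel_left] at ht
  rw [← ht, OrderIso.apply_symm_apply]

/-- Parallel lines in an extreme direction have parallel images. If `a ≤ b`, the first line lies
below the second, hence so do the images, and `exposed` applies; in general compare both lines with
one through a common upper bound. -/
theorem IsExtremeVector.map_parallel (hV : HasRichExtremeRays V) (φ : V ≃o V) {p : V}
    (hp : IsExtremeVector p) (a b : V) :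
    ∃ c : ℝ, φ (b + p) - φ b = c • (φ (a + p) - φ a) := by
  have hq : ∀ x, IsExtremeVector (φ (x + p) - φ x) := fun x =>
    IsExtremeVector.map_sub hV φ (by rwa [add_sub_cancel_left])
  have hle : ∀ x y, x ≤ y → ∃ c : ℝ, φ (x + p) - φ x = c • (φ (y + p) - φ y) := by
    intro x y hxy
    refine hV.exposed _ _ (φ y - φ x) (hq x) (hq y) fun s => ?_
    obtain ⟨t, ht⟩ := hp.exists_map_line_eq hV φ x s
    obtain ⟨s', hs'⟩ := hp.map_line hV φ y t
    refine ⟨s', ?_⟩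
    have h : φ (x + t • p) ≤ φ (y + t • p) := φ.monotone (by gcongr)
    rw [ht, hs'] at h
    rw [sub_add_eq_add_sub]
    exact le_sub_iff_add_le'.2 h
  obtain ⟨c, hac, hbc⟩ := hV.exists_ge a b
  obtain ⟨r, hr⟩ := hle a c hac
  obtain ⟨s, hs⟩ := hle b c hbc
  have hr0 : r ≠ 0 := by
    rintro rfl
    rw [zero_smul] at hr
    exact (hq a).1.ne' hr
  exact ⟨s * r⁻¹, by rw [hr, hs, smul_smul, inv_mul_cancel_right₀ hr0]⟩

/-- The image of a parallelogram spanned by two nonparallel extreme vectors is a parallelogram. -/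
theorem IsExtremeVector.map_parallelogram (hV : HasRichExtremeRays V) (φ : V ≃o V) {p p' : V}
    (hp : IsExtremeVector p) (hp' : IsExtremeVector p') (hne : ∀ c : ℝ, p' ≠ c • p) (a : V) :
    φ (a + p' + p) - φ (a + p') = φ (a + p) - φ a := by
  obtain ⟨c, hc⟩ := hp.map_parallel hV φ a (a + p')
  obtain ⟨c', hc'⟩ := hp'.map_parallel hV φ a (a + p)
  have hsum : (1 - c) • (φ (a + p) - φ a) = (1 - c') • (φ (a + p') - φ a) := by
    rw [sub_smul, sub_smul, one_smul, one_smul, ← hc, ← hc', add_right_comm a p p']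
    abel
  by_cases h : c' = 1
  · have hc1 : (1 - c) • (φ (a + p) - φ a) = 0 := by rw [hsum, h]; simp
    have hq : φ (a + p) - φ a ≠ 0 := by
      rw [sub_ne_zero, φ.injective.ne_iff]
      simpa using hp.1.ne'
    have : c = 1 := by
      have := (smul_eq_zero.1 hc1).resolve_right hq
      linarith
    rw [hc, this, one_smul]
  · exfalso
    have h1 : (1 - c') ≠ 0 := sub_ne_zero.2 (Ne.symm h)
    obtain ⟨t, ht⟩ := hp.exists_map_line_eq hV φ a ((1 - c')⁻¹ * (1 - c))
    rw [mul_smul, hsum, smul_smul, inv_mul_cancel₀ h1, one_smul, add_sub_cancel,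
      φ.injective.eq_iff, add_right_inj] at ht
    exact hne t ht.symm

/-- An order isomorphism fixing zero is additive. -/
theorem HasRichExtremeRays.map_add (hV : HasRichExtremeRays V) (φ : V ≃o V) (h0 : φ 0 = 0)
    (x y : V) : φ (x + y) = φ x + φ y := by
  -- Increments along an extreme vector do not depend on the base point.
  have hinc : ∀ p, IsExtremeVector p → ∀ d a, φ (a + d + p) - φ (a + d) = φ (a + p) - φ a := by
    intro p hp d
    have hd : d ∈ AddSubgroup.closure {q : V | IsExtremeVector q ∧ ∀ c : ℝ, q ≠ c • p} := by
      rw [hV.generates p hp]; trivial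
    induction hd using AddSubgroup.closure_induction with
    | mem q hq => exact hp.map_parallelogram hV φ hq.1 hq.2
    | zero => simp
    | add d e _ _ hd he => intro a; rw [← add_assoc, he, hd]
    | neg d _ hd =>
      intro a
      have := hd (a + -d)
      rw [neg_add_cancel_right] at this
      exact this.symm
  obtain ⟨p, hp⟩ := hV.exists_isExtremeVector
  have hy : y ∈ AddSubgroup.closure {q : V | IsExtremeVector q ∧ ∀ c : ℝ, q ≠ c • p} := by
    rw [hV.generates p hp]; trivial
  induction hy using AddSubgroup.closure_induction generalizing x with
  | mem q hq =>
    have := hinc q hq.1 x 0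
    rw [zero_add, zero_add, h0, sub_zero] at this
    rw [← this]; abel
  | zero => simp [h0]
  | add d e _ _ hd he => rw [← add_assoc, he, hd, he d, add_assoc]
  | neg d _ hd =>
    have h1 := hd (x + -d)
    have h2 := hd (-d)
    rw [neg_add_cancel_right] at h1
    rw [neg_add_cancel, h0] at h2
    rw [h1, add_assoc, add_comm (φ d), ← h2, add_zero]

theorem HasRichExtremeRays.map_smul_of_nonneg (hV : HasRichExtremeRays V) (φ : V ≃o V)
    (h0 : φ 0 = 0) (t : ℝ) {x : V} (hx : 0 ≤ x) : φ (t • x) = t • φ x := by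
  set f : V →+ V := ⟨⟨φ, h0⟩, hV.map_add φ h0⟩ with hf
  have hfq : ∀ r : ℚ, φ ((r : ℝ) • x) = (r : ℝ) • φ x := fun r => map_ratCast_smul f ℝ ℝ r x
  have hφx : 0 ≤ φ x := by rw [← h0]; exact φ.monotone hx
  -- Approximate `t` by rational numbers from either side.
  refine le_antisymm ?_ ?_
  · rw [← sub_nonpos]
    refine hV.archimedean _ (φ x) fun ε hε => ?_
    obtain ⟨r, hr1, hr2⟩ := exists_rat_btwn (lt_add_of_pos_right t hε)
    rw [sub_le_iff_le_add, ← add_smul, add_comm]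
    calc φ (t • x) ≤ φ ((r : ℝ) • x) := φ.monotone (smul_le_smul_of_nonneg_right hr1.le hx)
      _ = (r : ℝ) • φ x := hfq r
      _ ≤ _ := smul_le_smul_of_nonneg_right hr2.le hφx
  · rw [← sub_nonpos]
    refine hV.archimedean _ (φ x) fun ε hε => ?_
    obtain ⟨r, hr1, hr2⟩ := exists_rat_btwn (sub_lt_self t hε)
    rw [sub_le_comm, ← sub_smul]
    calc (t - ε) • φ x ≤ (r : ℝ) • φ x := smul_le_smul_of_nonneg_right hr1.le hφx
      _ = φ ((r : ℝ) • x) := (hfq r).symm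
      _ ≤ _ := φ.monotone (smul_le_smul_of_nonneg_right hr2.le hx)

/-- An order isomorphism fixing zero is linear. -/
theorem HasRichExtremeRays.exists_linearMap_eq (hV : HasRichExtremeRays V) (φ : V ≃o V)
    (h0 : φ 0 = 0) : ∃ L : V →ₗ[ℝ] V, ∀ x, L x = φ x := by
  have hadd := hV.map_add φ h0
  refine ⟨⟨⟨φ, hadd⟩, fun t x => ?_⟩, fun x => rfl⟩
  obtain ⟨u, hxu, h0u⟩ := hV.exists_ge x 0
  have h1 := hadd (t • x) (t • (u - x))
  have h2 := hadd x (u - x)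
  rw [← smul_add, add_sub_cancel, hV.map_smul_of_nonneg φ h0 t h0u,
    hV.map_smul_of_nonneg φ h0 t (sub_nonneg.2 hxu)] at h1
  rw [add_sub_cancel] at h2
  rw [h2, smul_add] at h1
  exact (add_right_cancel h1).symm

end Lines

end OrderedSpace

/-! ### The cone of positive semidefinite matrices -/

section PositiveSemidefinite

open Matrix

/-- In dimension at least two there is a vector `u` linearly independent of `v`. -/
theorem exists_not_parallel {ι : Type*} [DecidableEq ι] [Nontrivial ι] {v : ι → ℂ} (hv : v ≠ 0) :
    ∃ u : ι → ℂ, ∀ a b : ℂ, a • u + b • v = 0 → a = 0 := by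
  obtain ⟨i, hi⟩ := Function.ne_iff.1 hv
  obtain ⟨j, hj⟩ := exists_ne i
  refine ⟨Pi.single j 1, fun a b h => ?_⟩
  have h1 := congr_fun h i
  have h2 := congr_fun h j
  simp only [Pi.add_apply, Pi.smul_apply, Pi.single_eq_of_ne hj.symm, Pi.single_eq_same,
    smul_eq_mul, mul_zero, zero_add, mul_one, Pi.zero_apply] at h1 h2
  rwa [(mul_eq_zero.1 h1).resolve_right hi, zero_mul, add_zero] at h2

variable {ι : Type*} [Fintype ι]

/-- The quadratic form `w* A w` of a hermitian matrix, as a real linear functional of the matrix. -/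
def quadForm (w : ι → ℂ) : selfAdjoint (Matrix ι ι ℂ) →ₗ[ℝ] ℝ where
  toFun A := (star w ⬝ᵥ A.1 *ᵥ w).re
  map_add' A B := by simp [add_mulVec, dotProduct_add]
  map_smul' t A := by simp [smul_mulVec, dotProduct_smul]

/-- The hermitian matrix `v v*`. -/
def rankOne (v : ι → ℂ) : selfAdjoint (Matrix ι ι ℂ) :=
  ⟨vecMulVec v (star v), (posSemidef_vecMulVec_self_star v).1⟩

theorem rankOne_apply (v : ι → ℂ) (i j : ι) : (rankOne v).1 i j = v i * star (v j) := rfl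

theorem quadForm_rankOne (w v : ι → ℂ) :
    quadForm w (rankOne v) = ‖star w ⬝ᵥ v‖ ^ 2 := by
  change (star w ⬝ᵥ vecMulVec v (star v) *ᵥ w).re = _
  have h : star v ⬝ᵥ w = star (star w ⬝ᵥ v) := star_dotProduct v w
  rw [vecMulVec_mulVec, dotProduct_smul, h, ← Complex.normSq_eq_norm_sq]
  simp [Complex.normSq_apply]

theorem le_iff_quadForm (A B : selfAdjoint (Matrix ι ι ℂ)) :
    A ≤ B ↔ ∀ w, quadForm w A ≤ quadForm w B := by
  have key : A ≤ B ↔ (B.1 - A.1).PosSemidef := Iff.rfl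
  rw [key]
  have hsub : ∀ w, (star w ⬝ᵥ (B.1 - A.1) *ᵥ w).re = quadForm w B - quadForm w A := by
    intro w
    rw [← map_sub]; rfl
  constructor
  · intro h w
    rw [← sub_nonneg, ← hsub]
    exact (Complex.nonneg_iff.1 (h.dotProduct_mulVec_nonneg w)).1
  · intro h
    have hH : (B.1 - A.1).IsHermitian := (B - A).2
    refine PosSemidef.of_dotProduct_mulVec_nonneg hH fun w => ?_
    rw [Complex.nonneg_iff, hsub]
    exact ⟨sub_nonneg.2 (h w), (hH.im_star_dotProduct_mulVec_self w).symm⟩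

instance : IsOrderedModule ℝ (selfAdjoint (Matrix ι ι ℂ)) where
  smul_le_smul_of_nonneg_left t ht A B h := by
    rw [le_iff_quadForm] at h ⊢
    intro w
    rw [map_smul, map_smul]
    exact mul_le_mul_of_nonneg_left (h w) ht
  smul_le_smul_of_nonneg_right A hA s t h := by
    rw [le_iff_quadForm] at hA ⊢
    intro w
    rw [map_smul, map_smul]
    exact mul_le_mul_of_nonneg_right h (by simpa using hA w)

theorem rankOne_nonneg (v : ι → ℂ) : 0 ≤ rankOne v := by
  rw [le_iff_quadForm]
  intro w
  rw [map_zero, quadForm_rankOne]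
  positivity

theorem rankOne_smul (c : ℂ) (v : ι → ℂ) : rankOne (c • v) = ‖c‖ ^ 2 • rankOne v := by
  ext i j
  have h : c * star c = ((‖c‖ ^ 2 : ℝ) : ℂ) := by
    rw [← Complex.normSq_eq_norm_sq]; exact Complex.mul_conj c
  change c * v i * star (c * v j) = ((‖c‖ ^ 2 : ℝ) • (v i * star (v j)) : ℂ)
  rw [Complex.real_smul, ← h, star_mul']
  ring

/-- If everything orthogonal to `v` is orthogonal to `u`, then `u` is a multiple of `v`. -/
theorem exists_eq_smul_of_orthogonal {v u : ι → ℂ}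
    (h : ∀ w, star w ⬝ᵥ v = 0 → star w ⬝ᵥ u = 0) : ∃ c : ℂ, u = c • v := by
  by_cases hv : v = 0
  · refine ⟨0, ?_⟩
    have := h u (by simp [hv])
    rw [dotProduct_star_self_eq_zero] at this
    simp [this]
  have hvv : star v ⬝ᵥ v ≠ 0 := fun h0 => hv (dotProduct_star_self_eq_zero.1 h0)
  set c := (star v ⬝ᵥ u) / (star v ⬝ᵥ v)
  refine ⟨c, ?_⟩
  have h1 : star v ⬝ᵥ (u - c • v) = 0 := by
    rw [dotProduct_sub, dotProduct_smul, smul_eq_mul, div_mul_cancel₀ _ hvv, sub_self]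
  have h2 : star (u - c • v) ⬝ᵥ v = 0 := by
    rw [star_dotProduct, h1, star_zero]
  have h3 : star (u - c • v) ⬝ᵥ (u - c • v) = 0 := by
    rw [dotProduct_sub, dotProduct_smul, h2, h _ h2, smul_zero, sub_zero]
  rw [dotProduct_star_self_eq_zero] at h3
  exact sub_eq_zero.1 h3

theorem rankOne_eq_zero {v : ι → ℂ} : rankOne v = 0 ↔ v = 0 := by
  refine ⟨fun h => ?_, fun h => by ext i j; simp [rankOne_apply, h]⟩
  have := quadForm_rankOne v v
  rw [h, map_zero, eq_comm, sq_eq_zero_iff, norm_eq_zero] at this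
  exact dotProduct_star_self_eq_zero.1 this

/-- Rank one matrices are parallel only if the vectors are. -/
theorem exists_eq_smul_of_rankOne_eq_smul {u v : ι → ℂ} {t : ℝ}
    (h : rankOne u = t • rankOne v) : ∃ c : ℂ, u = c • v := by
  refine exists_eq_smul_of_orthogonal fun w hw => ?_
  have h1 := quadForm_rankOne w u
  rw [h, map_smul, quadForm_rankOne, hw, norm_zero] at h1
  simpa using h1.symm

theorem exists_eq_sum_rankOne {X : selfAdjoint (Matrix ι ι ℂ)} (hX : 0 ≤ X) :
    ∃ (m : ℕ) (u : Fin m → ι → ℂ), X = ∑ i, rankOne (u i) := by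
  have h : X.1.PosSemidef := by
    have h' : (X.1 - 0).PosSemidef := hX
    rwa [sub_zero] at h'
  obtain ⟨m, u, hu⟩ := posSemidef_iff_eq_sum_vecMulVec.1 h
  refine ⟨m, u, Subtype.ext ?_⟩
  rw [hu, AddSubgroup.val_finsetSum]
  rfl

theorem isExtremeVector_rankOne {v : ι → ℂ} (hv : v ≠ 0) : IsExtremeVector (rankOne v) := by
  refine ⟨(rankOne_nonneg v).lt_of_ne' (rankOne_eq_zero.not.2 hv), fun X hX hXv => ?_⟩
  obtain ⟨m, u, rfl⟩ := exists_eq_sum_rankOne hX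
  have hu : ∀ i, ∃ c : ℂ, u i = c • v := by
    intro i
    refine exists_eq_smul_of_orthogonal fun w hw => ?_
    have hle : rankOne (u i) ≤ rankOne v :=
      (Finset.single_le_sum (fun j _ => rankOne_nonneg (u j)) (Finset.mem_univ i)).trans hXv
    have := (le_iff_quadForm _ _).1 hle w
    rw [quadForm_rankOne, quadForm_rankOne, hw, norm_zero] at this
    rw [← norm_eq_zero, ← sq_eq_zero_iff]
    exact le_antisymm (by simpa using this) (sq_nonneg _)
  choose c hc using hu
  refine ⟨∑ i, ‖c i‖ ^ 2, ?_⟩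
  rw [Finset.sum_smul]
  exact Finset.sum_congr rfl fun i _ => by rw [hc i, rankOne_smul]

theorem IsExtremeVector.exists_eq_rankOne {X : selfAdjoint (Matrix ι ι ℂ)}
    (hX : IsExtremeVector X) : ∃ v : ι → ℂ, v ≠ 0 ∧ X = rankOne v := by
  obtain ⟨m, u, hu⟩ := exists_eq_sum_rankOne hX.1.le
  have hne : ∃ i, u i ≠ 0 := by
    by_contra! h
    refine hX.1.ne' (hu.trans (Finset.sum_eq_zero fun i _ => ?_))
    rw [rankOne_eq_zero.2 (h i)]
  obtain ⟨i, hi⟩ := hne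
  have hle : rankOne (u i) ≤ X := by
    rw [hu]
    exact Finset.single_le_sum (fun j _ => rankOne_nonneg (u j)) (Finset.mem_univ i)
  obtain ⟨t, ht⟩ := hX.2 _ (rankOne_nonneg _) hle
  have ht0 : t ≠ 0 := by
    rintro rfl
    rw [zero_smul] at ht
    exact hi (rankOne_eq_zero.1 ht)
  have htpos : 0 < t := by
    refine lt_of_le_of_ne (le_of_not_gt fun hneg => ?_) ht0.symm
    refine hi (rankOne_eq_zero.1 (le_antisymm ?_ (rankOne_nonneg _)))
    rw [ht]
    exact smul_nonpos_of_nonpos_of_nonneg hneg.le hX.1.le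
  refine ⟨((√t⁻¹ : ℝ) : ℂ) • u i, smul_ne_zero ?_ hi, ?_⟩
  · rw [Complex.ofReal_ne_zero]
    exact (Real.sqrt_pos.2 (inv_pos.2 htpos)).ne'
  · rw [rankOne_smul, Complex.norm_real, Real.norm_eq_abs, sq_abs,
      Real.sq_sqrt (inv_nonneg.2 htpos.le), ht, smul_smul, inv_mul_cancel₀ ht0, one_smul]

/-- The parallelogram law for rank one matrices. -/
theorem rankOne_add_add_rankOne_sub (u v : ι → ℂ) :
    rankOne (u + v) + rankOne (u - v) = (2 : ℝ) • (rankOne u + rankOne v) := by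
  ext i j
  change (u i + v i) * star (u j + v j) + (u i - v i) * star (u j - v j)
    = ((2 : ℝ) • (u i * star (u j) + v i * star (v j)) : ℂ)
  rw [Complex.real_smul, star_add, star_sub]
  push_cast
  ring

/-- Every hermitian matrix is a difference of two positive semidefinite ones: it is
`((A + 1) ^ 2 - (A - 1) ^ 2) / 4`. -/
theorem exists_eq_sub_of_nonneg [DecidableEq ι] (A : selfAdjoint (Matrix ι ι ℂ)) :
    ∃ X Y : selfAdjoint (Matrix ι ι ℂ), 0 ≤ X ∧ 0 ≤ Y ∧ A = X - Y := by
  have key : ∀ B : selfAdjoint (Matrix ι ι ℂ), ∃ C : selfAdjoint (Matrix ι ι ℂ),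
      0 ≤ C ∧ C.1 = B.1 * B.1 := by
    intro B
    have hB : B.1ᴴ = B.1 := B.2
    have h : (B.1 * B.1).PosSemidef := by
      have := posSemidef_conjTranspose_mul_self B.1
      rwa [hB] at this
    refine ⟨⟨B.1 * B.1, h.1⟩, ?_, rfl⟩
    change (B.1 * B.1 - 0).PosSemidef
    rwa [sub_zero]
  obtain ⟨C, hC, hC'⟩ := key (A + 1)
  obtain ⟨D, hD, hD'⟩ := key (A - 1)
  refine ⟨(1 / 4 : ℝ) • C, (1 / 4 : ℝ) • D, smul_nonneg (by norm_num) hC,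
    smul_nonneg (by norm_num) hD, Subtype.ext ?_⟩
  change A.1 = (1 / 4 : ℝ) • C.1 - (1 / 4 : ℝ) • D.1
  rw [hC', hD', ← smul_sub]
  change A.1 = (1 / 4 : ℝ) • ((A.1 + 1) * (A.1 + 1) - (A.1 - 1) * (A.1 - 1))
  have : (A.1 + 1) * (A.1 + 1) - (A.1 - 1) * (A.1 - 1) = (4 : ℝ) • A.1 := by
    rw [show (4 : ℝ) • A.1 = A.1 + A.1 + (A.1 + A.1) by
      rw [← two_smul ℝ A.1, ← two_smul ℝ ((2 : ℝ) • A.1), smul_smul]; norm_num]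
    noncomm_ring
  rw [this, smul_smul]
  norm_num

/-- Rank one matrices not parallel to a given one generate all hermitian matrices: the given one is
obtained from them by the parallelogram law. -/
theorem closure_rankOne_eq_top [DecidableEq ι] [Nontrivial ι] {v : ι → ℂ} (hv : v ≠ 0) :
    AddSubgroup.closure {q | IsExtremeVector q ∧ ∀ c : ℝ, q ≠ c • rankOne v} = ⊤ := by
  set G := AddSubgroup.closure {q | IsExtremeVector q ∧ ∀ c : ℝ, q ≠ c • rankOne v}
  have hmem : ∀ w : ι → ℂ, (∀ c : ℂ, w ≠ c • v) → rankOne w ∈ G := by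
    intro w hw
    have hw0 : w ≠ 0 := by simpa using hw 0
    refine AddSubgroup.subset_closure ⟨isExtremeVector_rankOne hw0, fun c hc => ?_⟩
    obtain ⟨d, hd⟩ := exists_eq_smul_of_rankOne_eq_smul hc
    exact hw d hd
  obtain ⟨u, hu⟩ := exists_not_parallel hv
  have hind : ∀ a b : ℂ, a ≠ 0 → ∀ c : ℂ, a • u + b • v ≠ c • v := by
    intro a b ha c h
    exact ha (hu a (b - c) (by rw [sub_smul, ← add_sub_assoc, h, sub_self]))
  have hall : ∀ w : ι → ℂ, rankOne w ∈ G := by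
    intro w
    by_cases hw : ∀ c : ℂ, w ≠ c • v
    · exact hmem w hw
    push Not at hw
    obtain ⟨c, rfl⟩ := hw
    -- Rescaling by `s = 1 / √2` keeps the parallelogram law free of the factor two.
    obtain ⟨s, hs0, hs⟩ : ∃ s : ℂ, s ≠ 0 ∧ ‖s‖ ^ 2 = 1 / 2 := by
      refine ⟨((√(1 / 2) : ℝ) : ℂ), ?_, ?_⟩
      · rw [Complex.ofReal_ne_zero]
        exact (Real.sqrt_pos.2 (by norm_num)).ne'
      · rw [Complex.norm_real, Real.norm_eq_abs, sq_abs, Real.sq_sqrt (by norm_num)]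
    have h : rankOne (s • u + s • c • v) + rankOne (s • u - s • c • v)
        = rankOne u + rankOne (c • v) := by
      rw [rankOne_add_add_rankOne_sub, rankOne_smul s u, rankOne_smul s (c • v), hs, ← smul_add,
        smul_smul]
      norm_num
    have h1 : rankOne (s • u + s • c • v) ∈ G := by
      rw [smul_smul]; exact hmem _ (hind _ _ hs0)
    have h2 : rankOne (s • u - s • c • v) ∈ G := by
      rw [smul_smul, sub_eq_add_neg, ← neg_smul]; exact hmem _ (hind _ _ hs0)
    have h3 : rankOne u ∈ G := by
      have := hmem ((1 : ℂ) • u + (0 : ℂ) • v) (hind _ _ one_ne_zero)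
      simpa using this
    rw [eq_sub_of_add_eq' h.symm]
    exact sub_mem (add_mem h1 h2) h3
  have hpos : ∀ X, 0 ≤ X → X ∈ G := by
    intro X hX
    obtain ⟨m, w, rfl⟩ := exists_eq_sum_rankOne hX
    exact sum_mem fun i _ => hall _
  rw [eq_top_iff]
  intro A _
  obtain ⟨X, Y, hX, hY, rfl⟩ := exists_eq_sub_of_nonneg A
  exact sub_mem (hpos X hX) (hpos Y hY)

theorem hasRichExtremeRays_selfAdjoint [DecidableEq ι] [Nontrivial ι] :
    HasRichExtremeRays (selfAdjoint (Matrix ι ι ℂ)) where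
  archimedean X Y h := by
    rw [le_iff_quadForm]
    intro w
    rw [map_zero]
    have h1 : ∀ ε : ℝ, 0 < ε → quadForm w X ≤ ε * quadForm w Y := fun ε hε => by
      have := (le_iff_quadForm _ _).1 (h ε hε) w
      rwa [map_smul] at this
    by_contra! hpos
    have hY : 0 < quadForm w Y := by simpa using hpos.trans_le (h1 1 one_pos)
    have h2 := h1 (quadForm w X / (2 * quadForm w Y)) (by positivity)
    rw [div_mul_eq_mul_div, mul_div_mul_right _ _ hY.ne'] at h2
    linarith
  exposed p q d hp hq h := by
    obtain ⟨a, -, rfl⟩ := hp.exists_eq_rankOne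
    obtain ⟨b, -, rfl⟩ := hq.exists_eq_rankOne
    have hab : ∃ c : ℂ, a = c • b := by
      refine exists_eq_smul_of_orthogonal fun w hw => ?_
      by_contra ha
      have hpos : 0 < ‖star w ⬝ᵥ a‖ ^ 2 := by positivity
      -- Evaluated at `w`, the line through `d` is constant and the other one is unbounded.
      obtain ⟨s', hs'⟩ := h ((quadForm w d + 1) / ‖star w ⬝ᵥ a‖ ^ 2)
      have := (le_iff_quadForm _ _).1 hs' w
      rw [map_smul, map_add, map_smul, quadForm_rankOne, quadForm_rankOne, hw, norm_zero,
        smul_eq_mul, smul_eq_mul, div_mul_cancel₀ _ hpos.ne'] at this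
      norm_num at this
    obtain ⟨c, rfl⟩ := hab
    exact ⟨‖c‖ ^ 2, rankOne_smul c b⟩
  generates p hp := by
    obtain ⟨v, hv, rfl⟩ := hp.exists_eq_rankOne
    exact closure_rankOne_eq_top hv
  exists_isExtremeVector := by
    obtain ⟨i⟩ := (inferInstance : Nonempty ι)
    exact ⟨_, isExtremeVector_rankOne (v := Pi.single i 1) (by simp)⟩

end PositiveSemidefinite

/-! ### Linear maps preserving rank one positive semidefinite matrices -/

section RankOnePreservers

open Matrix

variable {ι : Type*} [DecidableEq ι]

/-- The hermitian matrix with entry `z` at `(i, j)` and the conjugate of `z` at `(j, i)`; for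
`i = j` the two contributions add up. -/
def hermSingle (i j : ι) (z : ℂ) : selfAdjoint (Matrix ι ι ℂ) :=
  ⟨single i j z + single j i (star z), by
    rw [selfAdjoint.mem_iff, star_eq_conjTranspose, conjTranspose_add, conjTranspose_single,
      conjTranspose_single, star_star, add_comm]⟩

theorem hermSingle_apply (i j k l : ι) (z : ℂ) :
    (hermSingle i j z).1 k l
      = (if i = k ∧ j = l then z else 0) + (if j = k ∧ i = l then star z else 0) := by
  simp [hermSingle, single_apply]

theorem hermSingle_apply_same {i j : ι} (hij : i ≠ j) (z : ℂ) : (hermSingle i j z).1 i j = z := by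
  simp [hermSingle_apply, hij]

theorem hermSingle_add (i j : ι) (z w : ℂ) :
    hermSingle i j (z + w) = hermSingle i j z + hermSingle i j w := by
  ext k l
  change _ = (hermSingle i j z).1 k l + (hermSingle i j w).1 k l
  simp only [hermSingle_apply, star_add]
  split_ifs <;> ring

theorem hermSingle_smul (i j : ι) (t : ℝ) (z : ℂ) :
    hermSingle i j (t • z) = t • hermSingle i j z := by
  ext k l
  change _ = t • (hermSingle i j z).1 k l
  simp only [hermSingle_apply, star_smul, star_trivial]
  split_ifs <;> simp

theorem hermSingle_swap (i j : ι) (z : ℂ) : hermSingle j i (star z) = hermSingle i j z := by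
  ext k l
  rw [hermSingle_apply, hermSingle_apply, star_star, add_comm]

variable [Fintype ι]

theorem hermSingle_self (i : ι) (z : ℂ) :
    hermSingle i i z = (2 * z.re) • rankOne (Pi.single i 1) := by
  ext k l
  change _ = (2 * z.re) • (rankOne (Pi.single i 1 : ι → ℂ)).1 k l
  rw [hermSingle_apply, rankOne_apply]
  have h : z + star z = ((2 * z.re : ℝ) : ℂ) := Complex.add_conj z
  by_cases hk : i = k <;> by_cases hl : i = l <;> simp_all [eq_comm]

/-- A hermitian matrix is half the sum of the hermitian matrices carried by its single entries. -/
theorem two_smul_eq_sum_hermSingle (A : selfAdjoint (Matrix ι ι ℂ)) :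
    (2 : ℝ) • A = ∑ i, ∑ j, hermSingle i j (A.1 i j) := by
  have hA : ∀ i j, star (A.1 i j) = A.1 j i := fun i j => congr_fun₂ A.2 j i
  ext k l
  change (2 : ℝ) • A.1 k l = _
  simp only [AddSubgroup.val_finsetSum, Matrix.sum_apply, hermSingle_apply, hA,
    Finset.sum_add_distrib]
  simp only [ite_and, Finset.sum_ite_eq', Finset.mem_univ, if_true]
  rw [two_smul]
  simp

theorem rankOne_single_add_single {i j : ι} (hij : i ≠ j) (x y : ℂ) :
    rankOne (Pi.single i x + Pi.single j y) = ‖x‖ ^ 2 • rankOne (Pi.single i 1)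
      + ‖y‖ ^ 2 • rankOne (Pi.single j 1) + hermSingle i j (x * star y) := by
  have key : ∀ (m : ι) (z : ℂ), ‖z‖ ^ 2 • rankOne (Pi.single m 1) = rankOne (Pi.single m z) := by
    intro m z
    rw [← rankOne_smul, ← Pi.single_smul, smul_eq_mul, mul_one]
  rw [key, key]
  ext k l
  change _ = (rankOne (Pi.single i x)).1 k l + (rankOne (Pi.single j y)).1 k l
    + (hermSingle i j (x * star y)).1 k l
  simp only [hermSingle_apply, rankOne_apply, Pi.add_apply, Pi.single_apply, star_add, star_mul',
    star_star, eq_comm (a := k), eq_comm (a := l)]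
  by_cases h1 : i = k <;> by_cases h2 : j = k <;> by_cases h3 : i = l <;> by_cases h4 : j = l <;>
    simp [h1, h2, h3, h4, mul_comm] <;> simp_all

theorem quadForm_single (k : ι) (A : selfAdjoint (Matrix ι ι ℂ)) :
    quadForm (Pi.single k 1) A = (A.1 k k).re := by
  change (star (Pi.single k 1) ⬝ᵥ A.1 *ᵥ Pi.single k 1).re = _
  rw [← Pi.single_star, star_one]
  simp

/-- A linear map sending every `v v*` to some `w w*`. -/
def PreservesRankOne (L : selfAdjoint (Matrix ι ι ℂ) →ₗ[ℝ] selfAdjoint (Matrix ι ι ℂ)) : Prop :=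
  ∀ v, ∃ w, L (rankOne v) = rankOne w

variable {L : selfAdjoint (Matrix ι ι ℂ) →ₗ[ℝ] selfAdjoint (Matrix ι ι ℂ)}

/-- If the diagonal matrix units are fixed, so are all diagonal entries. For an off-diagonal
matrix `Z` this holds because `L` is nonnegative on a pencil `s² E_i + |z|² E_j + s Z`, whose
diagonal entries would otherwise become negative for a suitable real number `s`. -/
theorem PreservesRankOne.re_diag_eq (hL : PreservesRankOne L)
    (hE : ∀ i, L (rankOne (Pi.single i 1)) = rankOne (Pi.single i 1)) (k : ι)
    (A : selfAdjoint (Matrix ι ι ℂ)) : ((L A).1 k k).re = (A.1 k k).re := by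
  simp only [← quadForm_single]
  have hZ : ∀ i j z, quadForm (Pi.single k 1) (L (hermSingle i j z))
      = quadForm (Pi.single k 1) (hermSingle i j z) := by
    intro i j z
    by_cases hij : i = j
    · subst hij
      rw [hermSingle_self, map_smul, hE]
    have hnn : ∀ s : ℝ, 0 ≤ s ^ 2 * (if i = k then 1 else 0) + ‖z‖ ^ 2 * (if j = k then 1 else 0)
        + s * quadForm (Pi.single k 1) (L (hermSingle i j z)) := by
      intro s
      obtain ⟨w, hw⟩ := hL (Pi.single i (s : ℂ) + Pi.single j (star z))
      have h := rankOne_nonneg w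
      rw [← hw, rankOne_single_add_single hij, star_star, ← Complex.real_smul, hermSingle_smul,
        le_iff_quadForm] at h
      have h := h (Pi.single k 1)
      simp only [map_add, map_smul, hE, map_zero, smul_eq_mul, norm_star, Complex.norm_real,
        Real.norm_eq_abs, sq_abs] at h
      have hd : ∀ m, quadForm (Pi.single k 1) (rankOne (Pi.single m 1 : ι → ℂ))
          = if m = k then 1 else 0 := by
        intro m
        rw [quadForm_single, rankOne_apply]
        by_cases hm : m = k <;> simp [hm, eq_comm (a := k)]
      rwa [hd, hd] at h
    have hr : quadForm (Pi.single k 1) (hermSingle i j z) = 0 := by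
      rw [quadForm_single, hermSingle_apply, if_neg (fun h => hij (h.1.trans h.2.symm)),
        if_neg (fun h => hij (h.2.trans h.1.symm))]
      simp
    rw [hr]
    set g := quadForm (Pi.single k 1) (L (hermSingle i j z))
    by_contra hg
    by_cases hik : i = k
    · have h := hnn (-g / 2)
      rw [if_pos hik, if_neg (fun h => hij (hik.trans h.symm))] at h
      have : 0 < g ^ 2 := by positivity
      nlinarith
    · have h := hnn (-(‖z‖ ^ 2 + 1) / g)
      rw [if_neg hik, div_mul_cancel₀ _ hg] at h
      have : 0 ≤ ‖z‖ ^ 2 := by positivity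
      split_ifs at h <;> linarith
  have h2 : (2 : ℝ) • quadForm (Pi.single k 1) (L A) = (2 : ℝ) • quadForm (Pi.single k 1) A := by
    rw [← map_smul, ← map_smul, ← map_smul, two_smul_eq_sum_hermSingle]
    simp only [map_sum, hZ]
  exact smul_right_injective ℝ two_ne_zero h2

theorem PreservesRankOne.norm_eq (hL : PreservesRankOne L)
    (hE : ∀ i, L (rankOne (Pi.single i 1)) = rankOne (Pi.single i 1)) {v w : ι → ℂ}
    (h : L (rankOne v) = rankOne w) (k : ι) : ‖w k‖ = ‖v k‖ := by
  have key : ∀ u : ι → ℂ, ((rankOne u).1 k k).re = ‖u k‖ ^ 2 := by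
    intro u
    rw [rankOne_apply, ← Complex.normSq_eq_norm_sq, Complex.normSq_apply]
    simp
  have h1 := hL.re_diag_eq hE k (rankOne v)
  rw [h, key, key] at h1
  exact (sq_eq_sq₀ (norm_nonneg _) (norm_nonneg _)).1 h1

/-- Off the diagonal, an entry of `L A` depends on the corresponding entry of `A` only. -/
theorem PreservesRankOne.apply_eq (hL : PreservesRankOne L)
    (hE : ∀ i, L (rankOne (Pi.single i 1)) = rankOne (Pi.single i 1)) {i j : ι} (hij : i ≠ j)
    (A : selfAdjoint (Matrix ι ι ℂ)) : (L A).1 i j = (L (hermSingle i j (A.1 i j))).1 i j := by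
  have hEij : ∀ k, (rankOne (Pi.single k 1 : ι → ℂ)).1 i j = 0 := by
    intro k
    rw [rankOne_apply]
    by_cases h : i = k
    · rw [Pi.single_eq_of_ne (M := fun _ => ℂ) (fun h' => hij (h.trans h'.symm)), star_zero,
        mul_zero]
    · rw [Pi.single_eq_of_ne h, zero_mul]
  have hother : ∀ k l z, ¬(k = i ∧ l = j) → ¬(k = j ∧ l = i) →
      (L (hermSingle k l z)).1 i j = 0 := by
    intro k l z h1 h2
    by_cases hkl : k = l
    · subst hkl
      rw [hermSingle_self, map_smul, hE]
      change (2 * z.re) • (rankOne (Pi.single k 1 : ι → ℂ)).1 i j = 0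
      rw [hEij, smul_zero]
    -- The support of `v = e_k + z̄ e_l`, and hence that of its image, misses `i` or `j`.
    set v : ι → ℂ := Pi.single k 1 + Pi.single l (star z) with hv
    obtain ⟨w, hw⟩ := hL v
    have hwk := hL.norm_eq hE hw
    have hprod : w i * star (w j) = 0 := by
      have hz : ∀ m, m ≠ k → m ≠ l → w m = 0 := by
        intro m hmk hml
        rw [← norm_eq_zero, hwk, hv, Pi.add_apply, Pi.single_eq_of_ne hmk,
          Pi.single_eq_of_ne hml, add_zero, norm_zero]
      by_cases hi : i ≠ k ∧ i ≠ l
      · rw [hz i hi.1 hi.2, zero_mul]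
      · rw [hz j (by grind) (by grind), star_zero, mul_zero]
    rw [hv, rankOne_single_add_single hkl, map_add, map_add, map_smul, map_smul, hE, hE,
      star_star, one_mul] at hw
    have h := congr_arg (fun X : selfAdjoint (Matrix ι ι ℂ) => X.1 i j) hw
    change (‖(1 : ℂ)‖ ^ 2 : ℝ) • (rankOne (Pi.single k 1 : ι → ℂ)).1 i j
      + (‖star z‖ ^ 2 : ℝ) • (rankOne (Pi.single l 1 : ι → ℂ)).1 i j
      + (L (hermSingle k l z)).1 i j = w i * star (w j) at h
    rwa [hEij, hEij, smul_zero, smul_zero, zero_add, zero_add, hprod] at h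
  have hzero : ∀ B : selfAdjoint (Matrix ι ι ℂ), B.1 i j = 0 → (L B).1 i j = 0 := by
    intro B hB
    have hB' : B.1 j i = 0 := by
      have : star (B.1 i j) = B.1 j i := congr_fun₂ B.2 j i
      rw [← this, hB, star_zero]
    have hz : ∀ k l : ι, hermSingle k l (0 : ℂ) = 0 := by
      intro k l
      have := hermSingle_smul k l 0 0
      rwa [zero_smul, zero_smul] at this
    have h2 : (2 : ℝ) • (L B).1 i j = 0 := by
      change ((2 : ℝ) • L B).1 i j = 0
      rw [← map_smul, two_smul_eq_sum_hermSingle, map_sum, AddSubgroup.val_finsetSum,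
        Matrix.sum_apply]
      refine Finset.sum_eq_zero fun k _ => ?_
      rw [map_sum, AddSubgroup.val_finsetSum, Matrix.sum_apply]
      refine Finset.sum_eq_zero fun l _ => ?_
      by_cases h1 : k = i ∧ l = j
      · rw [h1.1, h1.2, hB, hz, map_zero]; rfl
      by_cases h2 : k = j ∧ l = i
      · rw [h2.1, h2.2, hB', hz, map_zero]; rfl
      exact hother k l _ h1 h2
    exact (smul_eq_zero.1 h2).resolve_left two_ne_zero
  have h := hzero (A - hermSingle i j (A.1 i j)) (by
    change A.1 i j - (hermSingle i j (A.1 i j)).1 i j = 0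
    rw [hermSingle_apply_same hij, sub_self])
  rw [map_sub] at h
  exact sub_eq_zero.1 h

/-- A norm preserving real linear map of `ℂ` fixing `1` maps `I` to `I` or to `-I`; here `e` is the
image of `I`, and `1 + e` that of `1 + I`. -/
theorem eq_I_or_eq_neg_I_of_norm_eq {e : ℂ} (h1 : ‖e‖ = 1) (h2 : ‖1 + e‖ ^ 2 = 2) :
    e = Complex.I ∨ e = -Complex.I := by
  have h1' : ‖e‖ ^ 2 = 1 := by rw [h1, one_pow]
  rw [← Complex.normSq_eq_norm_sq, Complex.normSq_apply] at h1' h2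
  simp only [Complex.add_re, Complex.add_im, Complex.one_re, Complex.one_im, zero_add] at h2
  have hre : e.re = 0 := by linarith
  have him : (e.im - 1) * (e.im + 1) = 0 := by rw [hre] at h1'; linarith
  rcases mul_eq_zero.1 him with h | h
  · left
    apply Complex.ext <;> simp [hre]; linarith
  · right
    apply Complex.ext <;> simp [hre]; linarith

/-- If `L` preserves rank one and fixes the diagonal matrix units and the all-ones matrix, it is the
identity or the transposition. By `apply_eq` each off-diagonal entry is transformed by an isometry
of `ℂ` fixing `1`, thus by the identity or by conjugation; testing on vectors whose entries are
`1` except for one entry `I` shows that the choice is the same for all entries. -/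
theorem PreservesRankOne.eq_id_or_transpose [Nontrivial ι] (hL : PreservesRankOne L)
    (hE : ∀ i, L (rankOne (Pi.single i 1)) = rankOne (Pi.single i 1))
    (hJ : L (rankOne 1) = rankOne 1) :
    (∀ A, (L A).1 = A.1) ∨ (∀ A, (L A).1 = A.1ᵀ) := by
  set u : ι → ι → ℂ → ℂ := fun i j z => (L (hermSingle i j z)).1 i j with hu
  have hLu : ∀ {i j}, i ≠ j → ∀ A, (L A).1 i j = u i j (A.1 i j) := fun hij A =>
    hL.apply_eq hE hij A
  have hvec : ∀ {i j}, i ≠ j → ∀ {v w}, L (rankOne v) = rankOne w →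
      w i * star (w j) = u i j (v i * star (v j)) := by
    intro i j hij v w h
    have := hLu hij (rankOne v)
    rw [h] at this
    exact this
  have hadd : ∀ i j z w, u i j (z + w) = u i j z + u i j w := by
    intro i j z w
    simp only [hu, hermSingle_add, map_add]
    rfl
  have hsmul : ∀ i j (t : ℝ) z, u i j (t • z) = t • u i j z := by
    intro i j t z
    simp only [hu, hermSingle_smul, map_smul]
    rfl
  have hone : ∀ {i j}, i ≠ j → u i j 1 = 1 := by
    intro i j hij
    have := hvec hij hJ
    simpa using this.symm
  have hnorm : ∀ {i j}, i ≠ j → ∀ z, ‖u i j z‖ = ‖z‖ := by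
    intro i j hij z
    obtain ⟨w, hw⟩ := hL (Pi.single i z + Pi.single j 1)
    have h1 := hvec hij hw
    have h2 := hL.norm_eq hE hw i
    have h3 := hL.norm_eq hE hw j
    simp only [Pi.add_apply, Pi.single_eq_same, Pi.single_eq_of_ne hij,
      Pi.single_eq_of_ne hij.symm, add_zero, zero_add, star_one, mul_one, norm_one] at h1 h2 h3
    rw [← h1, norm_mul, norm_star, h2, h3, mul_one]
  have hI : ∀ {i j}, i ≠ j → u i j Complex.I = Complex.I ∨ u i j Complex.I = -Complex.I := by
    intro i j hij
    refine eq_I_or_eq_neg_I_of_norm_eq (by rw [hnorm hij, Complex.norm_I]) ?_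
    rw [← hone hij, ← hadd, hnorm hij, ← Complex.normSq_eq_norm_sq, Complex.normSq_apply]
    simp
    norm_num
  have hrow : ∀ {i j k}, i ≠ j → i ≠ k → u i j Complex.I = u i k Complex.I := by
    intro i j k hij hik
    by_cases hjk : j = k
    · rw [hjk]
    obtain ⟨w, hw⟩ := hL (Function.update 1 i Complex.I)
    have h1 := hvec hij hw
    have h2 := hvec hik hw
    have h3 := hvec hjk hw
    have h4 := hL.norm_eq hE hw k
    simp only [Function.update_self, Function.update_of_ne hij.symm, Function.update_of_ne hik.symm,
      Pi.one_apply, star_one, mul_one, hone hjk, norm_one] at h1 h2 h3 h4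
    have h5 : star (w k) * w k = 1 := by
      have : star (w k) * w k = ((‖w k‖ ^ 2 : ℝ) : ℂ) := by
        rw [← Complex.normSq_eq_norm_sq]; exact Complex.normSq_eq_conj_mul_self.symm
      rw [this, h4]; simp
    have h6 : w j = w k := by
      rw [← mul_one (w j), ← h5, ← mul_assoc, h3, one_mul]
    rw [← h1, ← h2, h6]
  have hsymm : ∀ {i j}, i ≠ j → u j i Complex.I = u i j Complex.I := by
    intro i j hij
    have h1 : u j i Complex.I = star ((L (hermSingle j i Complex.I)).1 i j) :=
      (congr_fun₂ (L (hermSingle j i Complex.I)).2 j i).symm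
    have h2 : (L (hermSingle j i Complex.I)).1 i j = u i j ((-1 : ℝ) • Complex.I) := by
      have h : star Complex.I = (-1 : ℝ) • Complex.I := by simp
      rw [← hermSingle_swap, h]
    rw [h1, h2, hsmul]
    rcases hI hij with h | h <;> simp [h]
  have hall : ∀ {i j k l}, i ≠ j → k ≠ l → u i j Complex.I = u k l Complex.I := by
    intro i j k l hij hkl
    by_cases hli : i = l
    · subst hli
      rw [hrow hij hkl.symm, hsymm hkl]
    · rw [hrow hij hli, ← hsymm hli, hrow (Ne.symm hli) hkl.symm, hsymm hkl]
  have hform : ∀ {i j}, i ≠ j → ∀ z, u i j z = z.re + z.im * u i j Complex.I := by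
    intro i j hij z
    conv_lhs => rw [show z = z.re • 1 + z.im • Complex.I by simp]
    rw [hadd, hsmul, hsmul, hone hij, Complex.real_smul, Complex.real_smul, mul_one]
  have hdiag : ∀ (A : selfAdjoint (Matrix ι ι ℂ)) k, (L A).1 k k = A.1 k k := by
    intro A k
    have him : ∀ B : selfAdjoint (Matrix ι ι ℂ), (B.1 k k).im = 0 := fun B =>
      Complex.conj_eq_iff_im.1 (congr_fun₂ B.2 k k)
    exact Complex.ext (hL.re_diag_eq hE k A) (by rw [him, him])
  obtain ⟨i₀, j₀, h0⟩ := exists_pair_ne ι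
  rcases hI h0 with h | h
  · left
    intro A
    ext i j
    by_cases hij : i = j
    · rw [hij, hdiag]
    · rw [hLu hij, hform hij, hall hij h0, h, Complex.re_add_im]
  · right
    intro A
    ext i j
    rw [transpose_apply]
    by_cases hij : i = j
    · rw [hij, hdiag]
    · have hA : star (A.1 i j) = A.1 j i := congr_fun₂ A.2 j i
      rw [hLu hij, hform hij, hall hij h0, h, ← hA]
      apply Complex.ext <;> simp

/-- The congruence `A ↦ T A T*`. -/
def congruence (T : Matrix ι ι ℂ) :
    selfAdjoint (Matrix ι ι ℂ) →ₗ[ℝ] selfAdjoint (Matrix ι ι ℂ) where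
  toFun A := ⟨T * A.1 * Tᴴ, isHermitian_mul_mul_conjTranspose T A.2⟩
  map_add' A B := by ext1; simp [mul_add, add_mul]
  map_smul' t A := by ext1; simp

theorem congruence_rankOne (T : Matrix ι ι ℂ) (v : ι → ℂ) :
    congruence T (rankOne v) = rankOne (T *ᵥ v) := by
  ext1
  change T * vecMulVec v (star v) * Tᴴ = vecMulVec (T *ᵥ v) (star (T *ᵥ v))
  rw [mul_vecMulVec, vecMulVec_mul, star_mulVec]

theorem rankOne_le_smul_sum (v : ι → ℂ) :
    rankOne v ≤ (∑ i, ‖v i‖ ^ 2) • ∑ i, rankOne (Pi.single i 1) := by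
  rw [le_iff_quadForm]
  intro w
  rw [map_smul, map_sum, quadForm_rankOne, smul_eq_mul]
  simp only [quadForm_rankOne]
  simp only [dotProduct_single, mul_one, Pi.star_apply, norm_star]
  calc ‖star w ⬝ᵥ v‖ ^ 2 ≤ (∑ i, ‖v i‖ * ‖w i‖) ^ 2 := by
        gcongr
        refine (norm_sum_le _ _).trans_eq (Finset.sum_congr rfl fun i _ => ?_)
        rw [norm_mul, Pi.star_apply, norm_star, mul_comm]
    _ ≤ _ := Finset.sum_mul_sq_le_sq_mul_sq _ _ _

/-- A monotone linear map permuting the rank one positive semidefinite matrices is a congruence,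
possibly composed with the transposition. -/
theorem PreservesRankOne.exists_eq_congruence [Nontrivial ι] (hL : PreservesRankOne L)
    (hmono : Monotone L) (hsurj : ∀ w, ∃ v, L (rankOne v) = rankOne w) :
    ∃ T : Matrix ι ι ℂ, IsUnit T ∧
      ((∀ A, (L A).1 = T * A.1 * Tᴴ) ∨ (∀ A, (L A).1 = T * A.1ᵀ * Tᴴ)) := by
  choose b hb using fun i => hL (Pi.single i 1)
  set T : Matrix ι ι ℂ := of fun r i => b i r with hT
  have hTb : ∀ i, T *ᵥ Pi.single i 1 = b i := by
    intro i
    rw [mulVec_single_one]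
    rfl
  -- `T` is invertible because `L` maps `1 = ∑ E_i`, an order unit, to an order unit.
  have hTu : IsUnit T := by
    rw [← isUnit_conjTranspose, ← mulVec_injective_iff_isUnit,
      ← coe_mulVecLin, ← LinearMap.ker_eq_bot, LinearMap.ker_eq_bot']
    intro x hx
    obtain ⟨v, hv⟩ := hsurj x
    have h := (le_iff_quadForm _ _).1 (hmono (rankOne_le_smul_sum v)) x
    have hbx : ∀ i, star x ⬝ᵥ b i = 0 := by
      intro i
      have h1 : star (b i) ⬝ᵥ x = 0 := congr_fun hx i
      rw [star_dotProduct, h1, star_zero]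
    rw [hv, map_smul, map_smul, map_sum, map_sum, quadForm_rankOne] at h
    simp only [hb, quadForm_rankOne, hbx, norm_zero] at h
    have h2 : ‖star x ⬝ᵥ x‖ ^ 2 = 0 := le_antisymm (by simpa using h) (sq_nonneg _)
    rwa [sq_eq_zero_iff, norm_eq_zero, dotProduct_star_self_eq_zero] at h2
  have hTdet := (isUnit_iff_isUnit_det T).1 hTu
  have hL₁ : PreservesRankOne (congruence T⁻¹ ∘ₗ L) := by
    intro v
    obtain ⟨w, hw⟩ := hL v
    exact ⟨_, by rw [LinearMap.comp_apply, hw, congruence_rankOne]⟩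
  have hE₁ : ∀ i, (congruence T⁻¹ ∘ₗ L) (rankOne (Pi.single i 1)) = rankOne (Pi.single i 1) := by
    intro i
    rw [LinearMap.comp_apply, hb, congruence_rankOne, ← hTb, mulVec_mulVec,
      nonsing_inv_mul _ hTdet, one_mulVec]
  obtain ⟨c, hc⟩ := hL₁ 1
  have hc1 : ∀ k, star (c k) * c k = 1 := by
    intro k
    have h1 : ‖c k‖ = 1 := by simpa using hL₁.norm_eq hE₁ hc k
    have h2 : star (c k) * c k = ((‖c k‖ ^ 2 : ℝ) : ℂ) := by
      rw [← Complex.normSq_eq_norm_sq]; exact Complex.normSq_eq_conj_mul_self.symm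
    rw [h2, h1]; simp
  have hcT : diagonal (star c) * diagonal c = 1 := by
    rw [diagonal_mul_diagonal, ← diagonal_one]
    congr 1
    ext k
    exact hc1 k
  set M := congruence (diagonal (star c)) ∘ₗ congruence T⁻¹ ∘ₗ L with hM
  have hML : PreservesRankOne M := by
    intro v
    obtain ⟨w, hw⟩ := hL₁ v
    exact ⟨_, by rw [hM, LinearMap.comp_apply, hw, congruence_rankOne]⟩
  have hME : ∀ i, M (rankOne (Pi.single i 1)) = rankOne (Pi.single i 1) := by
    intro i
    have h : diagonal (star c) *ᵥ Pi.single i 1 = star (c i) • Pi.single i (1 : ℂ) := by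
      rw [diagonal_mulVec_single, ← Pi.single_smul]
      rfl
    have h1 : ‖c i‖ = 1 := by simpa using hL₁.norm_eq hE₁ hc i
    rw [hM, LinearMap.comp_apply, hE₁, congruence_rankOne, h, rankOne_smul, norm_star, h1, one_pow,
      one_smul]
  have hMJ : M (rankOne 1) = rankOne 1 := by
    rw [hM, LinearMap.comp_apply, hc, congruence_rankOne]
    congr 1
    ext k
    rw [mulVec_diagonal]
    exact hc1 k
  -- Undo the two normalisations.
  set U := T * diagonal c with hU
  have hUM : ∀ A, (L A).1 = U * (M A).1 * Uᴴ := by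
    intro A
    have h1 : (M A).1 = (diagonal (star c) * T⁻¹) * (L A).1 * (diagonal (star c) * T⁻¹)ᴴ := by
      change diagonal (star c) * (T⁻¹ * (L A).1 * (T⁻¹)ᴴ) * (diagonal (star c))ᴴ = _
      simp only [conjTranspose_mul, mul_assoc]
    have h2 : U * (diagonal (star c) * T⁻¹) = 1 := by
      rw [hU, mul_assoc, ← mul_assoc (diagonal c), mul_eq_one_comm.1 hcT, one_mul,
        mul_nonsing_inv _ hTdet]
    calc (L A).1 = (U * (diagonal (star c) * T⁻¹)) * (L A).1
          * (U * (diagonal (star c) * T⁻¹))ᴴ := by rw [h2]; simp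
      _ = _ := by rw [h1, conjTranspose_mul U]; simp only [mul_assoc]
  refine ⟨U, hTu.mul (IsUnit.of_mul_eq_one_right _ hcT), ?_⟩
  refine (hML.eq_id_or_transpose hME hMJ).imp (fun h A => ?_) fun h A => ?_
  · rw [hUM, h]
  · rw [hUM, h]

end RankOnePreservers

/-! ### Order automorphisms of hermitian matrices -/

/-- Rank one positive semidefinite matrices are the extreme vectors of the cone, which can be
described in terms of the order. -/
theorem exists_orderIso_rankOne_eq {ι : Type*} [Fintype ι] [DecidableEq ι] [Nontrivial ι]
    (φ : selfAdjoint (Matrix ι ι ℂ) ≃o selfAdjoint (Matrix ι ι ℂ)) (h0 : φ 0 = 0) (v : ι → ℂ) :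
    ∃ w, φ (rankOne v) = rankOne w := by
  by_cases hv : v = 0
  · exact ⟨0, by rw [rankOne_eq_zero.2 hv, h0, rankOne_eq_zero.2 rfl]⟩
  have h : IsExtremeVector (rankOne v - 0) := by
    rw [sub_zero]; exact isExtremeVector_rankOne hv
  have h1 := h.map_sub hasRichExtremeRays_selfAdjoint φ
  rw [h0, sub_zero] at h1
  obtain ⟨w, -, hw⟩ := h1.exists_eq_rankOne
  exact ⟨w, hw⟩

theorem theorem2p2 (n : ℕ) (hn : 2 ≤ n) (φ : HermMat n → HermMat n)
    (hbij : Function.Bijective φ)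
    (hord : ∀ A B : HermMat n, A.1 ≤ B.1 ↔ (φ A).1 ≤ (φ B).1) :
    ∃ (T : Matrix (Fin n) (Fin n) ℂ) (S : HermMat n), IsUnit T ∧
      ((∀ A : HermMat n, (φ A).1 = T * A.1 * T.conjTranspose + S.1) ∨
       (∀ A : HermMat n, (φ A).1 = T * A.1.transpose * T.conjTranspose + S.1)) := by
  have : Nontrivial (Fin n) := Fin.nontrivial_iff_two_le.2 hn
  let ψ : selfAdjoint (Matrix (Fin n) (Fin n) ℂ) ≃o selfAdjoint (Matrix (Fin n) (Fin n) ℂ) :=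
    { toEquiv := Equiv.ofBijective φ hbij
      map_rel_iff' := fun {A B} => (hord A B).symm }
  -- Translate so that zero becomes a fixed point.
  let θ := ψ.trans (OrderIso.addRight (-ψ 0))
  have hθ : ∀ A, θ A = ψ A - ψ 0 := fun A => (sub_eq_add_neg _ _).symm
  have h0 : θ 0 = 0 := by rw [hθ, sub_self]
  have h0' : θ.symm 0 = 0 := by rw [← h0, OrderIso.symm_apply_apply, h0]
  obtain ⟨L, hL⟩ := hasRichExtremeRays_selfAdjoint.exists_linearMap_eq θ h0
  have hLr : PreservesRankOne L := fun v => by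
    rw [hL]; exact exists_orderIso_rankOne_eq θ h0 v
  obtain ⟨T, hT, h⟩ := hLr.exists_eq_congruence
    (fun A B hAB => by rw [hL, hL]; exact θ.monotone hAB)
    (fun w => by
      obtain ⟨v, hv⟩ := exists_orderIso_rankOne_eq θ.symm h0' w
      exact ⟨v, by rw [hL, ← hv, OrderIso.apply_symm_apply]⟩)
  have hφ : ∀ A : selfAdjoint (Matrix (Fin n) (Fin n) ℂ), (ψ A).1 = (L A).1 + (ψ 0).1 := by
    intro A
    rw [hL, hθ]
    exact (sub_add_cancel (ψ A).1 (ψ 0).1).symm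
  exact ⟨T, ψ 0, hT, h.imp
    (fun h A => (hφ ⟨A.1, A.2⟩).trans (congr_arg (· + (ψ 0).1) (h ⟨A.1, A.2⟩)))
    (fun h A => (hφ ⟨A.1, A.2⟩).trans (congr_arg (· + (ψ 0).1) (h ⟨A.1, A.2⟩)))⟩
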